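/- Let $\mathbb K\in\{\mathbb R,\mathbb C\}$, let $X$ be an infinite-dimensional Banach space over $\mathbb K$, and let $(\Omega,\Sigma,\mu)$ be a measure space with $\mu$ positive and finite. A function $f:\Omega\to X$ is Pettis integrable if $x^*\circ f\in L_1(\mu)$ for every $x^*\in X^*$ and for every $A\in\Sigma$ there is $x_A\in X$ with $x^*(x_A)=\int_A x^*\circ f\,d\mu$ for all $x^*\in X^*$. Let $P_1(\mu,X)$ be the normed space of all ($\mu$-a.e. equivalence classes of) strongly $\mu$-measurable Pettis integrable functions $f:\Omega\to X$, with the norm $$\|f\|_{P_1(\mu,X)}=\sup\Big\{\int_\Omega |x^*f(\omega)|\,d\mu(\omega): x^*\in X^*,\ \|x^*\|\le 1\Big\},$$ and let $\widehat{P_1(\mu,X)}$ be its completion. Then the following hold. 1. If $\mu$ is not purely atomic (that is, some measurable set of positive measure contains no atom), then $\widehat{P_1(\mu,X)}$ has a separable quotient, i.e. there is a closed linear subspace $Y$ such that $\widehat{P_1(\mu,X)}/Y$ is separable and infinite-dimensional. 2. If the range $\{\mu(A):A\in\Sigma\}$ of $\mu$ is infinite and $X$ contains an isomorphic copy of $c_0$,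 then $\widehat{P_1(\mu,X)}$ contains a complemented subspace isomorphic to $c_0$. -/

import Mathlib

open MeasureTheory Filter Topology
open scoped ZeroAtInfty

/-! ### Atoms -/

section Atoms

variable {Ω : Type*} [MeasurableSpace Ω]

/-- `A` is an atom of `μ`: it is measurable, of positive measure, and each measurable subset of it
is null or differs from it by a null set. -/
def IsMeasureAtom (μ : Measure Ω) (A : Set Ω) : Prop :=
  MeasurableSet A ∧ 0 < μ A ∧
    ∀ B : Set Ω, MeasurableSet B → B ⊆ A → μ B = 0 ∨ μ (A \ B) = 0

/-- `μ` is purely atomic: each measurable set of positive measure contains an atom. -/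
def IsPurelyAtomic (μ : Measure Ω) : Prop :=
  ∀ A : Set Ω, MeasurableSet A → 0 < μ A → ∃ B ⊆ A, IsMeasureAtom μ B

end Atoms

/-! ### Quotients, copies and complemented copies -/

section Copies

variable (𝕜 : Type*) [RCLike 𝕜]

/-- `E` has a separable quotient: some quotient of `E` by a closed subspace is separable and
infinite-dimensional. -/
def HasSeparableQuotient (E : Type*) [NormedAddCommGroup E] [NormedSpace 𝕜 E] : Prop :=
  ∃ Y : Submodule 𝕜 E, IsClosed (Y : Set E) ∧
    TopologicalSpace.SeparableSpace (E ⧸ Y) ∧ ¬ FiniteDimensional 𝕜 (E ⧸ Y)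

/-- `E` contains an isomorphic copy of `Z`: some closed subspace of `E` is linearly homeomorphic
to `Z`. -/
def ContainsCopy (Z E : Type*) [NormedAddCommGroup Z] [NormedSpace 𝕜 Z]
    [NormedAddCommGroup E] [NormedSpace 𝕜 E] : Prop :=
  ∃ M : Submodule 𝕜 E, IsClosed (M : Set E) ∧ Nonempty (Z ≃L[𝕜] M)

/-- `E` contains a complemented copy of `Z`: some closed subspace of `E` is linearly homeomorphic
to `Z` and is the range of a continuous linear projection of `E`. -/
def ContainsComplementedCopy (Z E : Type*) [NormedAddCommGroup Z] [NormedSpace 𝕜 Z]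
    [NormedAddCommGroup E] [NormedSpace 𝕜 E] : Prop :=
  ∃ M : Submodule 𝕜 E, IsClosed (M : Set E) ∧ Nonempty (Z ≃L[𝕜] M) ∧ M.ClosedComplemented

end Copies

/-! ### The Pettis space -/

section Pettis

variable (𝕜 : Type*) [RCLike 𝕜] {Ω : Type*} [MeasurableSpace Ω]
  {X : Type*} [NormedAddCommGroup X] [NormedSpace 𝕜 X]

/-- `f` is Pettis integrable: it is scalarly integrable, and for each measurable set `A` there is a
vector `x` of `X` (the Pettis integral of `f` over `A`) with `φ x = ∫_A φ ∘ f dμ` for all `φ` in the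
dual of `X`. -/
def IsPettisIntegrable (μ : Measure Ω) (f : Ω → X) : Prop :=
  (∀ φ : StrongDual 𝕜 X, Integrable (fun ω => φ (f ω)) μ) ∧
    ∀ A : Set Ω, MeasurableSet A →
      ∃ x : X, ∀ φ : StrongDual 𝕜 X, φ x = ∫ ω in A, φ (f ω) ∂μ

/-- The semivariation norm `sup {∫ |φ ∘ f| dμ : φ in the dual of X, ‖φ‖ ≤ 1}`. -/
noncomputable def semivariationNorm (μ : Measure Ω) (f : Ω → X) : ℝ :=
  ⨆ φ : Metric.closedBall (0 : StrongDual 𝕜 X) 1, ∫ ω, ‖φ.1 (f ω)‖ ∂μ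

variable {𝕜}

theorem IsPettisIntegrable.congr {μ : Measure Ω} {f g : Ω → X} (hf : IsPettisIntegrable 𝕜 μ f)
    (h : f =ᵐ[μ] g) : IsPettisIntegrable 𝕜 μ g := by
  have key : ∀ φ : StrongDual 𝕜 X, (fun ω => φ (f ω)) =ᵐ[μ] fun ω => φ (g ω) := fun φ =>
    h.mono fun ω hω => by simp only [hω]
  refine ⟨fun φ => (hf.1 φ).congr (key φ), fun A hA => ?_⟩
  obtain ⟨x, hx⟩ := hf.2 A hA
  exact ⟨x, fun φ => (hx φ).trans (integral_congr_ae (ae_restrict_of_ae (key φ)))⟩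

theorem IsPettisIntegrable.zero {μ : Measure Ω} :
    IsPettisIntegrable 𝕜 μ (fun _ : Ω => (0 : X)) :=
  ⟨fun φ => by simp, fun A _ => ⟨0, fun φ => by simp⟩⟩

theorem IsPettisIntegrable.add {μ : Measure Ω} {f g : Ω → X} (hf : IsPettisIntegrable 𝕜 μ f)
    (hg : IsPettisIntegrable 𝕜 μ g) : IsPettisIntegrable 𝕜 μ (fun ω => f ω + g ω) := by
  refine ⟨fun φ => ((hf.1 φ).add (hg.1 φ)).congr (ae_of_all _ fun ω => (map_add φ _ _).symm),
    fun A hA => ?_⟩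
  obtain ⟨x, hx⟩ := hf.2 A hA
  obtain ⟨y, hy⟩ := hg.2 A hA
  refine ⟨x + y, fun φ => ?_⟩
  simp only [map_add, hx, hy]
  exact (integral_add (hf.1 φ).integrableOn (hg.1 φ).integrableOn).symm

theorem IsPettisIntegrable.smul {μ : Measure Ω} {f : Ω → X} (c : 𝕜)
    (hf : IsPettisIntegrable 𝕜 μ f) : IsPettisIntegrable 𝕜 μ (fun ω => c • f ω) := by
  refine ⟨fun φ => by simpa using (hf.1 φ).const_mul c, fun A hA => ?_⟩
  obtain ⟨x, hx⟩ := hf.2 A hA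
  refine ⟨c • x, fun φ => ?_⟩
  simp only [map_smul, hx, smul_eq_mul]
  exact (integral_const_mul c _).symm

theorem IsPettisIntegrable.bddAbove {μ : Measure Ω} {f : Ω → X} (hf : IsPettisIntegrable 𝕜 μ f) :
    BddAbove (Set.range fun φ : Metric.closedBall (0 : StrongDual 𝕜 X) 1 =>
      ∫ ω, ‖φ.1 (f ω)‖ ∂μ) := by
  let g : StrongDual 𝕜 X →ₗ[𝕜] Lp 𝕜 1 μ :=
    { toFun := fun φ => (hf.1 φ).toL1 _
      map_add' := fun φ ψ => by
        rw [← Integrable.toL1_add]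
        rfl
      map_smul' := fun c φ => by
        rw [RingHom.id_apply, ← Integrable.toL1_smul]
        rfl }
  have hg : Continuous g := by
    refine g.continuous_of_seq_closed_graph fun u φ y hu hy => ?_
    have hm : TendstoInMeasure μ (fun n => (g (u n) : Ω → 𝕜)) atTop y :=
      tendstoInMeasure_of_tendsto_Lp hy
    obtain ⟨ns, hns, hlim⟩ := hm.exists_seq_tendsto_ae
    have hcoe : ∀ᵐ ω ∂μ, ∀ n, (g (u n) : Ω → 𝕜) ω = u n (f ω) :=
      ae_all_iff.2 fun n => (hf.1 (u n)).coeFn_toL1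
    apply Lp.ext
    filter_upwards [hlim, hcoe, (hf.1 φ).coeFn_toL1] with ω h1 h2 h3
    have h4 : Tendsto (fun n => u (ns n) (f ω)) atTop (𝓝 (φ (f ω))) :=
      ((ContinuousLinearMap.apply 𝕜 𝕜 (f ω)).continuous.tendsto φ).comp
        (hu.comp hns.tendsto_atTop)
    simp only [h2] at h1
    rw [tendsto_nhds_unique h1 h4]
    exact h3.symm
  let G : StrongDual 𝕜 X →L[𝕜] Lp 𝕜 1 μ := ⟨g, hg⟩
  refine ⟨‖G‖, ?_⟩
  rintro _ ⟨φ, rfl⟩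
  have h1 : ∫ ω, ‖φ.1 (f ω)‖ ∂μ = ‖G φ.1‖ := by
    rw [L1.norm_eq_integral_norm]
    refine integral_congr_ae ?_
    filter_upwards [(hf.1 φ.1).coeFn_toL1] with ω hω
    exact congrArg norm hω.symm
  have h2 : ‖φ.1‖ ≤ 1 := mem_closedBall_zero_iff.1 φ.2
  calc ∫ ω, ‖φ.1 (f ω)‖ ∂μ = ‖G φ.1‖ := h1
    _ ≤ ‖G‖ * ‖φ.1‖ := G.le_opNorm _
    _ ≤ ‖G‖ := mul_le_of_le_one_right G.opNorm_nonneg h2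

theorem semivariationNorm_congr {μ : Measure Ω} {f g : Ω → X} (h : f =ᵐ[μ] g) :
    semivariationNorm 𝕜 μ f = semivariationNorm 𝕜 μ g := by
  unfold semivariationNorm
  refine iSup_congr fun φ => integral_congr_ae ?_
  filter_upwards [h] with ω hω
  rw [hω]

theorem semivariationNorm_zero {μ : Measure Ω} :
    semivariationNorm 𝕜 μ (fun _ : Ω => (0 : X)) = 0 := by
  simp [semivariationNorm]

theorem semivariationNorm_nonneg {μ : Measure Ω} (f : Ω → X) : 0 ≤ semivariationNorm 𝕜 μ f :=
  Real.iSup_nonneg fun _ => integral_nonneg fun _ => norm_nonneg _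

theorem semivariationNorm_add_le {μ : Measure Ω} {f g : Ω → X} (hf : IsPettisIntegrable 𝕜 μ f)
    (hg : IsPettisIntegrable 𝕜 μ g) :
    semivariationNorm 𝕜 μ (fun ω => f ω + g ω) ≤
      semivariationNorm 𝕜 μ f + semivariationNorm 𝕜 μ g := by
  have : Nonempty (Metric.closedBall (0 : StrongDual 𝕜 X) 1) := ⟨⟨0, by simp⟩⟩
  refine ciSup_le fun φ => ?_
  calc ∫ ω, ‖φ.1 (f ω + g ω)‖ ∂μ
      ≤ ∫ ω, (‖φ.1 (f ω)‖ + ‖φ.1 (g ω)‖) ∂μ := by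
        refine integral_mono ((hf.add hg).1 φ.1).norm
          ((hf.1 φ.1).norm.add (hg.1 φ.1).norm) fun ω => ?_
        simpa using norm_add_le (φ.1 (f ω)) (φ.1 (g ω))
    _ = ∫ ω, ‖φ.1 (f ω)‖ ∂μ + ∫ ω, ‖φ.1 (g ω)‖ ∂μ :=
        integral_add (hf.1 φ.1).norm (hg.1 φ.1).norm
    _ ≤ _ := add_le_add (le_ciSup hf.bddAbove φ) (le_ciSup hg.bddAbove φ)

theorem semivariationNorm_smul {μ : Measure Ω} (c : 𝕜) (f : Ω → X) :
    semivariationNorm 𝕜 μ (fun ω => c • f ω) = ‖c‖ * semivariationNorm 𝕜 μ f := by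
  unfold semivariationNorm
  rw [Real.mul_iSup_of_nonneg (norm_nonneg c)]
  refine iSup_congr fun φ => ?_
  rw [← integral_const_mul]
  simp

theorem IsPettisIntegrable.ae_eq_zero {μ : Measure Ω} {f : Ω → X} (hf : IsPettisIntegrable 𝕜 μ f)
    (hm : AEStronglyMeasurable f μ) (h : semivariationNorm 𝕜 μ f = 0) : f =ᵐ[μ] 0 := by
  have h0 : ∀ φ : Metric.closedBall (0 : StrongDual 𝕜 X) 1,
      (fun ω => φ.1 (f ω)) =ᵐ[μ] 0 := fun φ => by
    have h1 : ∫ ω, ‖φ.1 (f ω)‖ ∂μ = 0 :=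
      le_antisymm ((le_ciSup hf.bddAbove φ).trans h.le) (integral_nonneg fun _ => norm_nonneg _)
    have h2 := (integral_eq_zero_iff_of_nonneg (fun _ => norm_nonneg _) (hf.1 φ.1).norm).1 h1
    filter_upwards [h2] with ω hω
    simpa using hω
  obtain ⟨t, ht, hft⟩ := hm.isSeparable_ae_range
  refine ae_eq_zero_of_forall_dual_of_isSeparable 𝕜 ht (fun φ => ?_) hft
  have hpos : (0 : ℝ) < ‖φ‖ + 1 := by positivity
  have hc : (((‖φ‖ + 1 : ℝ) : 𝕜))⁻¹ ≠ 0 := inv_ne_zero (by exact_mod_cast hpos.ne')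
  have hball : (((‖φ‖ + 1 : ℝ) : 𝕜))⁻¹ • φ ∈ Metric.closedBall (0 : StrongDual 𝕜 X) 1 := by
    rw [mem_closedBall_zero_iff, norm_smul, norm_inv, RCLike.norm_ofReal, abs_of_pos hpos,
      inv_mul_le_one₀ hpos]
    linarith
  filter_upwards [h0 ⟨_, hball⟩] with ω hω
  have : (((‖φ‖ + 1 : ℝ) : 𝕜))⁻¹ * φ (f ω) = 0 := by simpa using hω
  simpa using (mul_eq_zero.1 this).resolve_left hc

variable (𝕜) in
/-- The classes, modulo `μ`-a.e. equality, of strongly `μ`-measurable Pettis integrable functions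
`Ω → X`. -/
def pettisSubmodule (μ : Measure Ω) (X : Type*) [NormedAddCommGroup X] [NormedSpace 𝕜 X] :
    Submodule 𝕜 (Ω →ₘ[μ] X) where
  carrier := {f | IsPettisIntegrable 𝕜 μ f}
  zero_mem' := IsPettisIntegrable.zero.congr AEEqFun.coeFn_zero.symm
  add_mem' := fun {f g} hf hg =>
    (IsPettisIntegrable.add hf hg).congr (AEEqFun.coeFn_add f g).symm
  smul_mem' := fun c f hf => (IsPettisIntegrable.smul c hf).congr (AEEqFun.coeFn_smul c f).symm

variable (𝕜) in
/-- The space `P₁(μ, X)`; it carries the semivariation norm. -/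
def PettisSpace (μ : Measure Ω) (X : Type*) [NormedAddCommGroup X] [NormedSpace 𝕜 X] : Type _ :=
  pettisSubmodule 𝕜 μ X

namespace PettisSpace

variable {μ : Measure Ω}

noncomputable instance : AddCommGroup (PettisSpace 𝕜 μ X) :=
  inferInstanceAs (AddCommGroup (pettisSubmodule 𝕜 μ X))

noncomputable instance : Module 𝕜 (PettisSpace 𝕜 μ X) :=
  inferInstanceAs (Module 𝕜 (pettisSubmodule 𝕜 μ X))

noncomputable instance : Norm (PettisSpace 𝕜 μ X) :=
  ⟨fun f => semivariationNorm 𝕜 μ (f.1 : Ω → X)⟩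

theorem norm_def (f : PettisSpace 𝕜 μ X) : ‖f‖ = semivariationNorm 𝕜 μ (f.1 : Ω → X) := rfl

theorem core : NormedSpace.Core 𝕜 (PettisSpace 𝕜 μ X) where
  norm_nonneg f := semivariationNorm_nonneg _
  norm_smul c f := by
    rw [norm_def, norm_def, ← semivariationNorm_smul]
    exact semivariationNorm_congr (AEEqFun.coeFn_smul c f.1)
  norm_triangle f g := by
    rw [norm_def, norm_def, norm_def]
    exact (semivariationNorm_congr (AEEqFun.coeFn_add f.1 g.1)).le.trans
      (semivariationNorm_add_le f.2 g.2)
  norm_eq_zero_iff f := by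
    constructor
    · intro h
      have h1 : (f.1 : Ω → X) =ᵐ[μ] 0 :=
        IsPettisIntegrable.ae_eq_zero f.2 f.1.aestronglyMeasurable h
      exact Subtype.ext (AEEqFun.ext (h1.trans AEEqFun.coeFn_zero.symm))
    · rintro rfl
      rw [norm_def]
      exact (semivariationNorm_congr AEEqFun.coeFn_zero).trans semivariationNorm_zero

noncomputable instance : NormedAddCommGroup (PettisSpace 𝕜 μ X) :=
  NormedAddCommGroup.ofCore core

noncomputable instance : NormedSpace 𝕜 (PettisSpace 𝕜 μ X) :=
  NormedSpace.ofCore core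

end PettisSpace

end Pettis

/-! Both parts rest on a biorthogonal system built from disjoint measurable sets `A n` of positive
measure. Given vectors `x n` and functionals `φ n` with `φ n (x n) = 1`, the averaged indicators `g
n = μ(A n)⁻¹ χ_{A n} x n` are biorthogonal to the functionals `F n : f ↦ ∫_{A n} φ n ∘ f dμ`, which
extend to the completion.

For the separable quotient, one pair `x`, `φ` serves all `n`. Disjointness gives `∑ |F n f| ≤ ‖φ‖
‖f‖`, so `∑ F n f • g n` converges and differs from `f` by an element of the common kernel of the `F
n`. The quotient by that kernel is therefore the closed span of the classes of the `g n`, which are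
linearly independent.

For the complemented copy of `c₀`, the `x n` are the unit vectors of a copy of `c₀` in `X`, and the
`φ n` extend the coordinate functionals. Since `∑ |θ (x n)|` is bounded over the dual unit ball, `a
↦ ∑ a n • g n` is bounded on `c₀`; `f ↦ (F n f)` is its left inverse once `F n f → 0`. This limit is
the crux: by Orlicz–Pettis (`tendsto_zero_of_hasSum_indicator`), the Pettis integrals of `f` over
the `A n` tend to zero in norm, and the uniform bound on the `F n` carries the limit to the
completion. -/

/-! ### The diagonal form of Schur's lemma and the Orlicz–Pettis theorem -/

section OrliczPettis

/-- If the rows of a matrix are absolutely summable and, for each set `S` of columns, the sums of the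
rows over `S` tend to zero, then the diagonal tends to zero. -/
theorem tendsto_diagonal_of_forall_tendsto_tsum_indicator {E : Type*} [NormedAddCommGroup E]
    [CompleteSpace E] {a : ℕ → ℕ → E} (ha : ∀ n, Summable fun k => ‖a n k‖)
    (h : ∀ S : Set ℕ, Tendsto (fun n => ∑' k, S.indicator (a n) k) atTop (𝓝 0)) :
    Tendsto (fun n => a n n) atTop (𝓝 0) := by
  by_contra hcon
  obtain ⟨ε, hε, hfreq⟩ : ∃ ε > 0, ∃ᶠ n in atTop, ε ≤ ‖a n n‖ := by
    rw [Metric.tendsto_nhds] at hcon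
    push Not at hcon
    obtain ⟨ε, hε, h1⟩ := hcon
    exact ⟨ε, hε, h1.mono fun n hn => by simpa using hn⟩
  have hcol : ∀ k, Tendsto (fun n => ‖a n k‖) atTop (𝓝 0) := fun k => by
    refine tendsto_zero_iff_norm_tendsto_zero.1 ((h {k}).congr fun n => ?_)
    rw [tsum_eq_single k fun b hb => Set.indicator_of_notMem (by simpa using hb) _]
    simp
  -- Gliding hump: row `n` has a large diagonal entry, and its mass outside the block `[N, N')`
  -- containing `n` is below `ε / 2`.
  have hstep : ∀ N : ℕ, ∃ n N' : ℕ, N ≤ n ∧ n < N' ∧ ε ≤ ‖a n n‖ ∧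
      ∑ k ∈ Finset.range N, ‖a n k‖ < ε / 4 ∧ ∑' k, ‖a n (k + N')‖ < ε / 4 := fun N => by
    have h1 : Tendsto (fun n => ∑ k ∈ Finset.range N, ‖a n k‖) atTop (𝓝 0) := by
      simpa using tendsto_finsetSum (Finset.range N) fun k _ => hcol k
    obtain ⟨n, hn, hnN, hns⟩ := (hfreq.and_eventually
      ((eventually_ge_atTop N).and (h1.eventually_lt_const (by positivity : 0 < ε / 4)))).exists
    obtain ⟨N', hN', hn'⟩ := (((tendsto_sum_nat_add fun k => ‖a n k‖).eventually_lt_const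
      (by positivity : 0 < ε / 4)).and (eventually_gt_atTop n)).exists
    exact ⟨n, N', hnN, hn', hn, hns, hN'⟩
  choose p q hp hpq hdiag hhead htail using hstep
  obtain ⟨N, hNs⟩ : ∃ N : ℕ → ℕ, ∀ i, N (i + 1) = q (N i) :=
    ⟨fun i => q^[i] 0, fun i => Function.iterate_succ_apply' q i 0⟩
  have hN : StrictMono N := strictMono_nat_of_lt_succ fun i => by
    rw [hNs]
    exact (hp _).trans_lt (hpq _)
  -- One diagonal index per block. The sum of such a row over `S` is its diagonal entry up to `ε /
  -- 2`, so these sums cannot tend to zero.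
  obtain ⟨S, hSdef⟩ : ∃ S : Set ℕ, S = Set.range fun i => p (N i) := ⟨_, rfl⟩
  have hS : ∀ i k, N i ≤ k → k < N (i + 1) → k ∈ S → k = p (N i) := by
    intro i k h1 h2 hk
    rw [hSdef] at hk
    obtain ⟨j, rfl⟩ := hk
    have h3 : p (N j) < N (j + 1) := by
      rw [hNs]
      exact hpq _
    have h4 : i < j + 1 := hN.lt_iff_lt.1 (h1.trans_lt h3)
    have h5 : j < i + 1 := hN.lt_iff_lt.1 ((hp _).trans_lt h2)
    obtain rfl : i = j := by omega
    rfl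
  have hbig : ∀ i, ε / 2 ≤ ‖∑' k, S.indicator (a (p (N i))) k‖ := fun i => by
    obtain ⟨n, hn⟩ : ∃ n, n = p (N i) := ⟨_, rfl⟩
    have hnS : n ∈ S := by
      rw [hSdef, hn]
      exact Set.mem_range_self i
    rw [← hn]
    have hle : ∀ k, ‖S.indicator (a n) k‖ ≤ ‖a n k‖ := fun k => norm_indicator_le_norm_self _ _
    have hsumn : Summable fun k => ‖S.indicator (a n) k‖ :=
      (ha n).of_nonneg_of_le (fun _ => norm_nonneg _) hle
    have hsum : Summable fun k => S.indicator (a n) k := hsumn.of_norm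
    have hlt : N i ≤ n := (hp _).trans hn.ge
    have hlt' : n < N (i + 1) := by
      rw [hNs, hn]
      exact hpq _
    have h1 : ∑ k ∈ Finset.Ico (N i) (N (i + 1)), S.indicator (a n) k = a n n := by
      rw [Finset.sum_eq_single_of_mem n (Finset.mem_Ico.2 ⟨hlt, hlt'⟩)]
      · exact Set.indicator_of_mem hnS _
      · intro k hk hkn
        rw [Finset.mem_Ico] at hk
        exact Set.indicator_of_notMem (fun hkS => hkn ((hS i k hk.1 hk.2 hkS).trans hn.symm)) _
    have h2 : ‖∑ k ∈ Finset.range (N i), S.indicator (a n) k‖ ≤ ε / 4 := by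
      refine (norm_sum_le_of_le (Finset.range (N i)) fun k _ => hle k).trans ?_
      rw [hn]
      exact (hhead (N i)).le
    have h3 : ‖∑' k, S.indicator (a n) (k + N (i + 1))‖ ≤ ε / 4 := by
      have hs1 : Summable fun k => ‖S.indicator (a n) (k + N (i + 1))‖ :=
        (summable_nat_add_iff (f := fun k => ‖S.indicator (a n) k‖) (N (i + 1))).2 hsumn
      have hs2 : Summable fun k => ‖a n (k + N (i + 1))‖ :=
        (summable_nat_add_iff (f := fun k => ‖a n k‖) (N (i + 1))).2 (ha n)
      refine (norm_tsum_le_tsum_norm hs1).trans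
        ((hs1.tsum_le_tsum (fun k => hle _) hs2).trans ?_)
      rw [hNs, hn]
      exact (htail _).le
    have h4 : a n n = ∑' k, S.indicator (a n) k
        - ∑ k ∈ Finset.range (N i), S.indicator (a n) k
        - ∑' k, S.indicator (a n) (k + N (i + 1)) := by
      rw [← hsum.sum_add_tsum_nat_add (N (i + 1)),
        ← Finset.sum_range_add_sum_Ico _ (hN (Nat.lt_succ_self i)).le, h1]
      abel
    have h5 : ε ≤ ‖a n n‖ := by
      rw [hn]
      exact hdiag (N i)
    rw [h4] at h5
    have h6 := norm_sub_le (∑' k, S.indicator (a n) k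
        - ∑ k ∈ Finset.range (N i), S.indicator (a n) k)
        (∑' k, S.indicator (a n) (k + N (i + 1)))
    have h7 := norm_sub_le (∑' k, S.indicator (a n) k)
        (∑ k ∈ Finset.range (N i), S.indicator (a n) k)
    linarith
  have hpN : Tendsto (fun i => p (N i)) atTop atTop :=
    tendsto_atTop_mono (fun i => hp _) hN.tendsto_atTop
  have hlim := ((h S).comp hpN).norm
  rw [norm_zero] at hlim
  have := ge_of_tendsto' hlim hbig
  linarith

variable {𝕜 : Type*} [RCLike 𝕜] {X : Type*} [NormedAddCommGroup X] [NormedSpace 𝕜 X]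

/-- A point outside a closed subspace is detected by a functional vanishing on the subspace. -/
theorem mem_of_forall_dual_eq_zero {Y : Submodule 𝕜 X} (hY : IsClosed (Y : Set X)) {x : X}
    (hx : ∀ φ : StrongDual 𝕜 X, (∀ y ∈ Y, φ y = 0) → φ x = 0) : x ∈ Y := by
  have : IsClosed (Y : Set X) := hY
  by_contra hcon
  have h0 : ‖Y.mkQL x‖ ≠ 0 := by
    rw [norm_ne_zero_iff]
    simpa using hcon
  obtain ⟨g, -, hg⟩ := exists_dual_vector 𝕜 (Y.mkQL x) h0
  have h1 : (g.comp Y.mkQL) x = 0 := hx _ fun y hy => by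
    have : Y.mkQL y = 0 := by simpa using hy
    simp [this]
  rw [ContinuousLinearMap.comp_apply, hg] at h1
  exact h0 (by exact_mod_cast h1)

/-- Separability makes the dual ball weak-* sequentially compact, so norming functionals of the
terms have a subsequence converging weak-* to some `φ'`. The diagonal lemma handles their
differences from `φ'`, while `φ' (x n) → 0` by summability. -/
theorem tendsto_zero_of_hasSum_indicator_of_separable [TopologicalSpace.SeparableSpace X]
    {x : ℕ → X} (h : ∀ S : Set ℕ, ∃ y : X, ∀ φ : StrongDual 𝕜 X,
      HasSum (S.indicator fun n => φ (x n)) (φ y)) :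
    Tendsto x atTop (𝓝 0) := by
  refine tendsto_of_subseq_tendsto fun ns hns => ?_
  obtain ⟨u, hu, hnu⟩ := strictMono_subseq_of_tendsto_atTop hns
  choose ψ hψ hψx using fun n => exists_dual_vector'' 𝕜 (x (ns (u n)))
  obtain ⟨φ, -, v, hv, hφ⟩ := WeakDual.isSeqCompact_closedBall 𝕜 X 0 1
    (x := fun n => StrongDual.toWeakDual (ψ n)) (fun n => by simpa using hψ n)
  have hφ' : ∀ y, Tendsto (fun n => ψ (v n) y) atTop (𝓝 (φ y)) := fun y =>
    (WeakDual.eval_continuous y).continuousAt.tendsto.comp hφ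
  let φ' : StrongDual 𝕜 X := WeakDual.toStrongDual φ
  have hφ'' : ∀ y, φ y = φ' y := fun _ => rfl
  let w : ℕ → ℕ := fun n => ns (u (v n))
  have hw : StrictMono w := hnu.comp hv
  refine ⟨fun n => u (v n), ?_⟩
  -- Subseries convergence passes to the subsequence because `w` is injective: a set `S` of indices
  -- becomes `w '' S`.
  have hsub : ∀ S : Set ℕ, ∃ y : X, ∀ θ : StrongDual 𝕜 X,
      HasSum (S.indicator fun n => θ (x (w n))) (θ y) := fun S => by
    obtain ⟨y, hy⟩ := h (w '' S)
    refine ⟨y, fun θ => ?_⟩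
    have h1 := hy θ
    rw [← hw.injective.hasSum_iff] at h1
    · convert h1 using 1
      ext n
      by_cases hn : n ∈ S
      · rw [Function.comp_apply, Set.indicator_of_mem hn,
          Set.indicator_of_mem (Set.mem_image_of_mem w hn)]
      · rw [Function.comp_apply, Set.indicator_of_notMem hn,
          Set.indicator_of_notMem (fun h => hn (hw.injective.mem_set_image.1 h))]
    · intro n hn
      exact Set.indicator_of_notMem (fun hnS => hn (Set.image_subset_range _ _ hnS)) _
  have hsummable : ∀ θ : StrongDual 𝕜 X, Summable fun n => θ (x (w n)) := fun θ => by
    obtain ⟨y, hy⟩ := hsub Set.univ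
    simpa using (hy θ).summable
  have hdiag : Tendsto (fun n => (ψ (v n) - φ') (x (w n))) atTop (𝓝 0) := by
    refine tendsto_diagonal_of_forall_tendsto_tsum_indicator
      (a := fun n k => (ψ (v n) - φ') (x (w k))) (fun n => (hsummable _).norm) fun S => ?_
    obtain ⟨y, hy⟩ := hsub S
    have h1 : ∀ n, ∑' k, S.indicator (fun k => (ψ (v n) - φ') (x (w k))) k = (ψ (v n) - φ') y :=
      fun n => (hy _).tsum_eq
    simp only [h1]
    simpa [hφ''] using (hφ' y).sub_const (φ' y)
  have h2 := hdiag.add (hsummable φ').tendsto_atTop_zero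
  simp only [_root_.sub_apply, sub_add_cancel, add_zero] at h2
  rw [tendsto_zero_iff_norm_tendsto_zero] at h2 ⊢
  refine h2.congr fun n => ?_
  rw [hψx]
  simp

/-- **Orlicz–Pettis**: the terms of a weakly subseries convergent series tend to zero in norm. -/
theorem tendsto_zero_of_hasSum_indicator {x : ℕ → X}
    (h : ∀ S : Set ℕ, ∃ y : X, ∀ φ : StrongDual 𝕜 X,
      HasSum (S.indicator fun n => φ (x n)) (φ y)) :
    Tendsto x atTop (𝓝 0) := by
  let Y : Submodule 𝕜 X := (Submodule.span 𝕜 (Set.range x)).topologicalClosure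
  have hYc : IsClosed (Y : Set X) := Submodule.isClosed_topologicalClosure _
  have hxY : ∀ n, x n ∈ Y := fun n =>
    Submodule.le_topologicalClosure _ (Submodule.subset_span ⟨n, rfl⟩)
  have : TopologicalSpace.SeparableSpace Y := by
    refine TopologicalSpace.IsSeparable.separableSpace (s := (Y : Set X)) ?_
    exact ((Set.countable_range x).isSeparable.span (R := 𝕜)).closure
  have hY : Tendsto (fun n => (⟨x n, hxY n⟩ : Y)) atTop (𝓝 0) := by
    refine tendsto_zero_of_hasSum_indicator_of_separable (𝕜 := 𝕜) fun S => ?_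
    obtain ⟨y, hy⟩ := h S
    -- A functional vanishing on the closed span kills every term, hence also the weak sum.
    have hyY : y ∈ Y := mem_of_forall_dual_eq_zero hYc fun φ hφ => by
      refine (hy φ).unique ?_
      simp [hφ _ (hxY _)]
    refine ⟨⟨y, hyY⟩, fun φ => ?_⟩
    obtain ⟨θ, hθ, -⟩ := exists_extension_norm_eq Y φ
    have h1 := hy θ
    rw [← hθ ⟨y, hyY⟩]
    convert h1 using 3 with n
    exact (hθ ⟨x n, hxY n⟩).symm
  exact (continuous_subtype_val.tendsto (0 : Y)).comp hY

end OrliczPettis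

/-! ### Disjoint sequences of sets of positive measure -/

section DisjointSequences

variable {Ω : Type*} [MeasurableSpace Ω] {μ : Measure Ω}

/-- If each set of a nonempty family contains another one with non-null difference, then there is a disjoint sequence of measurable sets of positive measure. -/
theorem exists_pairwise_disjoint_of_split {P : Set Ω → Prop} (hP : ∀ B, P B → MeasurableSet B)
    {B₀ : Set Ω} (h₀ : P B₀) (h : ∀ B, P B → ∃ C ⊆ B, P C ∧ μ (B \ C) ≠ 0) :
    ∃ A : ℕ → Set Ω, (∀ n, MeasurableSet (A n)) ∧ Pairwise (Function.onFun Disjoint A) ∧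
      ∀ n, μ (A n) ≠ 0 := by
  choose c hc hPc hμ using h
  -- Iterated splitting gives a decreasing sequence; the successive differences are the required
  -- sets.
  let B : ℕ → {B // P B} := fun n => Nat.rec ⟨B₀, h₀⟩ (fun _ B => ⟨c B.1 B.2, hPc B.1 B.2⟩) n
  have hB : Antitone fun n => (B n).1 := antitone_nat_of_succ_le fun n => hc _ (B n).2
  refine ⟨fun n => (B n).1 \ (B (n + 1)).1,
    fun n => (hP _ (B n).2).diff (hP _ (B (n + 1)).2), ?_, fun n => hμ _ (B n).2⟩
  refine (pairwise_disjoint_on _).2 fun m n hmn => ?_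
  rw [Set.disjoint_left]
  exact fun ω h1 h2 => h1.2 (hB (Nat.succ_le_of_lt hmn) h2.1)

theorem exists_pairwise_disjoint_of_not_isPurelyAtomic (h : ¬ IsPurelyAtomic μ) :
    ∃ A : ℕ → Set Ω, (∀ n, MeasurableSet (A n)) ∧ Pairwise (Function.onFun Disjoint A) ∧
      ∀ n, μ (A n) ≠ 0 := by
  unfold IsPurelyAtomic at h
  push Not at h
  obtain ⟨A, hA, hpos, hatom⟩ := h
  refine exists_pairwise_disjoint_of_split
    (P := fun B => MeasurableSet B ∧ B ⊆ A ∧ 0 < μ B) (fun B hB => hB.1)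
    ⟨hA, subset_rfl, hpos⟩ ?_
  rintro B ⟨hB, hBA, hBpos⟩
  have h1 := hatom B hBA
  unfold IsMeasureAtom at h1
  push Not at h1
  obtain ⟨C, hC, hCB, h2, h3⟩ := h1 hB hBpos
  exact ⟨C, hCB, ⟨hC, hCB.trans hBA, pos_iff_ne_zero.2 h2⟩, h3⟩

theorem exists_pairwise_disjoint_of_infinite_range
    (h : Set.Infinite {r : ENNReal | ∃ A : Set Ω, MeasurableSet A ∧ μ A = r}) :
    ∃ A : ℕ → Set Ω, (∀ n, MeasurableSet (A n)) ∧ Pairwise (Function.onFun Disjoint A) ∧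
      ∀ n, μ (A n) ≠ 0 := by
  -- The family consists of the sets on whose measurable subsets `μ` takes infinitely many values.
  let V : Set Ω → Set ENNReal := fun B => {r | ∃ A ⊆ B, MeasurableSet A ∧ μ A = r}
  refine exists_pairwise_disjoint_of_split
    (P := fun B => MeasurableSet B ∧ (V B).Infinite) (fun B hB => hB.1) (B₀ := Set.univ)
    ⟨MeasurableSet.univ, by simpa [V] using h⟩ ?_
  rintro B ⟨hB, hV⟩
  obtain ⟨_, ⟨D, hDB, hD, rfl⟩, hDv⟩ := hV.exists_notMem_finite (Set.toFinite {0, μ B})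
  simp only [Set.mem_insert_iff, Set.mem_singleton_iff, not_or] at hDv
  have hBD : μ (B \ D) ≠ 0 := fun h0 => by
    refine hDv.2 ((measure_mono hDB).antisymm ?_)
    rw [← measure_inter_add_sdiff B hD, h0, add_zero]
    exact measure_mono Set.inter_subset_right
  -- By additivity, `V D` and `V (B \ D)` cannot both be finite. An infinite one is kept, and the
  -- discarded piece has positive measure in either case.
  have hsub : V B ⊆ Set.image2 (· + ·) (V D) (V (B \ D)) := by
    rintro _ ⟨A, hAB, hA, rfl⟩
    exact ⟨_, ⟨A ∩ D, Set.inter_subset_right, hA.inter hD, rfl⟩, _,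
      ⟨A \ D, Set.sdiff_subset_sdiff_left hAB, hA.diff hD, rfl⟩, measure_inter_add_sdiff A hD⟩
  by_cases hfin : (V D).Finite
  · refine ⟨B \ D, Set.sdiff_subset, ⟨hB.diff hD, fun hfin' =>
      hV ((hfin.image2 _ hfin').subset hsub)⟩, ?_⟩
    rw [Set.sdiff_sdiff_cancel_left hDB]
    exact hDv.1
  · exact ⟨D, hDB, ⟨hD, hfin⟩, hBD⟩

end DisjointSequences

/-! ### Criteria in terms of biorthogonal sequences -/

section Biorthogonal

variable {𝕜 : Type*} [RCLike 𝕜] {E : Type*} [NormedAddCommGroup E] [NormedSpace 𝕜 E]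
  [CompleteSpace E]

/-- A bounded sequence with a biorthogonal sequence of functionals that sends the space into `ℓ¹`
yields a separable quotient. -/
theorem hasSeparableQuotient_of_summable {F : ℕ → StrongDual 𝕜 E} {g : ℕ → E} {C : ℝ}
    (hg : ∀ n, ‖g n‖ ≤ C) (hFg : ∀ m n, F m (g n) = if m = n then 1 else 0)
    (hF : ∀ f, Summable fun n => ‖F n f‖) : HasSeparableQuotient 𝕜 E := by
  let Y : Submodule 𝕜 E := ⨅ n, (F n).ker
  have hYmem : ∀ f, f ∈ Y ↔ ∀ n, F n f = 0 := fun f => by simp [Y, Submodule.mem_iInf]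
  have hYc : IsClosed (Y : Set E) := by
    have : (Y : Set E) = ⋂ n, {f | F n f = 0} := by
      ext f
      simp [hYmem]
    rw [this]
    exact isClosed_iInter fun n => isClosed_eq (F n).continuous continuous_const
  refine ⟨Y, hYc, ?_, fun hfin => ?_⟩
  · have hclosure : TopologicalSpace.IsSeparable
        (closure (Submodule.span 𝕜 (Set.range fun n => Y.mkQL (g n)) : Set (E ⧸ Y))) :=
      ((Set.countable_range _).isSeparable.span (R := 𝕜)).closure
    rw [← TopologicalSpace.isSeparable_univ_iff]
    refine hclosure.mono fun q _ => ?_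
    obtain ⟨f, rfl⟩ := Y.mkQ_surjective q
    have hsum : Summable fun n => F n f • g n := by
      refine Summable.of_norm_bounded ((hF f).mul_right C) fun n => ?_
      rw [norm_smul]
      exact mul_le_mul_of_nonneg_left (hg n) (norm_nonneg _)
    -- By biorthogonality the series has the same image as `f` under every `F m`.
    have hmem : f - ∑' n, F n f • g n ∈ Y := (hYmem _).2 fun m => by
      rw [map_sub, (F m).map_tsum hsum, tsum_eq_single m]
      · simp [hFg]
      · intro n hn
        simp [hFg, hn.symm]
    have heq : Y.mkQ f = ∑' n, F n f • Y.mkQL (g n) := by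
      have h1 : Y.mkQ f = Y.mkQL (∑' n, F n f • g n) :=
        (Submodule.Quotient.eq Y).2 hmem
      rw [h1, Y.mkQL.map_tsum hsum]
      simp
    rw [heq]
    have hsum' : Summable fun n => F n f • Y.mkQL (g n) := by
      simpa [Function.comp_def] using hsum.map Y.mkQL Y.mkQL.continuous
    refine mem_closure_of_tendsto hsum'.hasSum (Eventually.of_forall fun s => ?_)
    exact Submodule.sum_mem _ fun n _ => Submodule.smul_mem _ _ (Submodule.subset_span ⟨n, rfl⟩)
  · have hind : LinearIndependent 𝕜 fun n => Y.mkQ (g n) := by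
      rw [linearIndependent_iff']
      intro s c hc m hm
      have h1 : ∑ n ∈ s, c n • g n ∈ Y := by
        rw [← Submodule.ker_mkQ Y, LinearMap.mem_ker]
        simpa using hc
      have h2 := (hYmem _).1 h1 m
      simpa [hFg, hm] using h2
    have := hind.finite
    exact not_finite ℕ

/-- A sequence with bounded multipliers in `c₀` and a bounded biorthogonal sequence of functionals
that tends to zero pointwise yields a complemented copy of `c₀`. -/
theorem containsComplementedCopy_of_tendsto {F : ℕ → StrongDual 𝕜 E} {g : ℕ → E} {C D : ℝ}
    (hg : ∀ (s : Finset ℕ) (a : ℕ → 𝕜) (r : ℝ), 0 ≤ r → (∀ n ∈ s, ‖a n‖ ≤ r) →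
      ‖∑ n ∈ s, a n • g n‖ ≤ C * r)
    (hFg : ∀ m n, F m (g n) = if m = n then 1 else 0) (hFD : ∀ n f, ‖F n f‖ ≤ D * ‖f‖)
    (hF : ∀ f, Tendsto (fun n => F n f) atTop (𝓝 0)) :
    ContainsComplementedCopy 𝕜 C₀(ℕ, 𝕜) E := by
  have hcoc : cocompact ℕ = atTop := by rw [cocompact_eq_cofinite, Nat.cofinite_eq_atTop]
  have happly : ∀ (a : C₀(ℕ, 𝕜)) n, ‖a n‖ ≤ ‖a‖ := fun a n => a.toBCF.norm_coe_le_norm n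
  let T : E →L[𝕜] C₀(ℕ, 𝕜) := LinearMap.mkContinuous
    { toFun := fun f => ⟨⟨fun n => F n f, continuous_of_discreteTopology⟩, by
        rw [hcoc]
        exact hF f⟩
      map_add' := fun f f' => by
        ext n
        exact map_add (F n) f f'
      map_smul' := fun c f => by
        ext n
        exact map_smul (F n) c f } D fun f => by
      refine (BoundedContinuousFunction.norm_le ((norm_nonneg _).trans (hFD 0 f))).2 fun n => ?_
      exact hFD n f
  have hTapply : ∀ f n, T f n = F n f := fun _ _ => rfl
  have hsum : ∀ a : C₀(ℕ, 𝕜), Summable fun n => a n • g n := fun a => by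
    have ha : Tendsto a atTop (𝓝 0) := hcoc ▸ a.zero_at_infty'
    rw [summable_iff_vanishing_norm]
    intro ε hε
    -- The sign of `C` is not assumed; `|C| + 1` is a safe divisor.
    have hC : 0 < |C| + 1 := by positivity
    obtain ⟨N, hN⟩ := Metric.tendsto_atTop.1 ha (ε / (|C| + 1)) (by positivity)
    refine ⟨Finset.range N, fun t ht => ?_⟩
    have h1 : ∀ n ∈ t, ‖a n‖ ≤ ε / (|C| + 1) := fun n hn => by
      have hnN : N ≤ n := by
        by_contra hlt
        exact (Finset.disjoint_left.1 ht hn) (Finset.mem_range.2 (not_le.1 hlt))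
      simpa using (hN n hnN).le
    calc ‖∑ n ∈ t, a n • g n‖ ≤ C * (ε / (|C| + 1)) := hg t a _ (by positivity) h1
      _ ≤ |C| * (ε / (|C| + 1)) := by
        gcongr
        exact le_abs_self C
      _ < (|C| + 1) * (ε / (|C| + 1)) := by
        gcongr
        linarith
      _ = ε := mul_div_cancel₀ _ hC.ne'
  let J : C₀(ℕ, 𝕜) →L[𝕜] E := LinearMap.mkContinuous
    { toFun := fun a => ∑' n, a n • g n
      map_add' := fun a b => by
        rw [← (hsum a).tsum_add (hsum b)]
        simp [add_smul]
      map_smul' := fun c a => by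
        rw [RingHom.id_apply, ← (hsum a).tsum_const_smul c]
        simp [smul_smul] } C fun a => by
      refine le_of_tendsto (hsum a).hasSum.norm (Eventually.of_forall fun s => ?_)
      exact hg s a _ (norm_nonneg _) fun n _ => happly a n
  have hTJ : Function.LeftInverse T J := fun a => by
    ext m
    rw [hTapply]
    change F m (∑' n, a n • g n) = a m
    rw [(F m).map_tsum (hsum a), tsum_eq_single m]
    · simp [hFg]
    · intro n hn
      simp [hFg, hn.symm]
  have hJ : J.HasLeftInverse := ⟨T, hTJ⟩
  exact ⟨J.range, hJ.isClosed_range, ⟨J.equivRange hTJ.injective hJ.isClosed_range⟩,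
    hJ.closedComplemented_range⟩

end Biorthogonal

/-! ### Functionals and indicator functions on the Pettis space -/

namespace PettisSpace

variable {𝕜 : Type*} [RCLike 𝕜] {Ω : Type*} [MeasurableSpace Ω] {μ : Measure Ω}
  {X : Type*} [NormedAddCommGroup X] [NormedSpace 𝕜 X]

theorem coeFn_add (f g : PettisSpace 𝕜 μ X) :
    ((f + g).1 : Ω → X) =ᵐ[μ] fun ω => (f.1 : Ω → X) ω + (g.1 : Ω → X) ω :=
  AEEqFun.coeFn_add f.1 g.1

theorem coeFn_smul (c : 𝕜) (f : PettisSpace 𝕜 μ X) :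
    ((c • f).1 : Ω → X) =ᵐ[μ] fun ω => c • (f.1 : Ω → X) ω :=
  AEEqFun.coeFn_smul c f.1

theorem integrable_dual (φ : StrongDual 𝕜 X) (f : PettisSpace 𝕜 μ X) :
    Integrable (fun ω => φ ((f.1 : Ω → X) ω)) μ :=
  f.2.1 φ

/-- Composition with a functional, as a linear map into `L¹`. -/
noncomputable def toL1 (φ : StrongDual 𝕜 X) : PettisSpace 𝕜 μ X →ₗ[𝕜] Lp 𝕜 1 μ where
  toFun f := (integrable_dual φ f).toL1 _
  map_add' f g := by
    rw [← Integrable.toL1_add, Integrable.toL1_eq_toL1_iff]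
    filter_upwards [coeFn_add f g] with ω hω
    simp [hω]
  map_smul' c f := by
    rw [RingHom.id_apply, ← Integrable.toL1_smul, Integrable.toL1_eq_toL1_iff]
    filter_upwards [coeFn_smul c f] with ω hω
    simp [hω]

theorem coeFn_toL1 (φ : StrongDual 𝕜 X) (f : PettisSpace 𝕜 μ X) :
    (toL1 φ f : Ω → 𝕜) =ᵐ[μ] fun ω => φ ((f.1 : Ω → X) ω) :=
  (integrable_dual φ f).coeFn_toL1

theorem norm_toL1 (φ : StrongDual 𝕜 X) (f : PettisSpace 𝕜 μ X) :
    ‖toL1 φ f‖ = ∫ ω, ‖φ ((f.1 : Ω → X) ω)‖ ∂μ := by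
  rw [L1.norm_eq_integral_norm]
  refine integral_congr_ae ?_
  filter_upwards [coeFn_toL1 φ f] with ω hω
  rw [hω]

theorem norm_le_of_forall_toL1 {f : PettisSpace 𝕜 μ X} {r : ℝ}
    (h : ∀ φ : StrongDual 𝕜 X, ‖φ‖ ≤ 1 → ‖toL1 φ f‖ ≤ r) : ‖f‖ ≤ r := by
  have : Nonempty (Metric.closedBall (0 : StrongDual 𝕜 X) 1) := ⟨⟨0, by simp⟩⟩
  refine ciSup_le fun φ => ?_
  rw [← norm_toL1]
  exact h _ (mem_closedBall_zero_iff.1 φ.2)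

theorem norm_toL1_le (φ : StrongDual 𝕜 X) (f : PettisSpace 𝕜 μ X) :
    ‖toL1 φ f‖ ≤ ‖φ‖ * ‖f‖ := by
  rw [norm_toL1]
  rcases eq_or_ne φ 0 with rfl | hφ
  · simp
  have hpos : 0 < ‖φ‖ := norm_pos_iff.2 hφ
  have hball : ((‖φ‖ : 𝕜)⁻¹) • φ ∈ Metric.closedBall (0 : StrongDual 𝕜 X) 1 := by
    rw [mem_closedBall_zero_iff, norm_smul, norm_inv, RCLike.norm_ofReal, abs_of_pos hpos,
      inv_mul_cancel₀ hpos.ne']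
  have h1 : ∫ ω, ‖(((‖φ‖ : 𝕜)⁻¹) • φ) ((f.1 : Ω → X) ω)‖ ∂μ ≤ ‖f‖ :=
    le_ciSup (IsPettisIntegrable.bddAbove f.2) ⟨_, hball⟩
  have h2 : ∫ ω, ‖(((‖φ‖ : 𝕜)⁻¹) • φ) ((f.1 : Ω → X) ω)‖ ∂μ
      = ‖φ‖⁻¹ * ∫ ω, ‖φ ((f.1 : Ω → X) ω)‖ ∂μ := by
    rw [← integral_const_mul]
    simp
  rw [h2, inv_mul_le_iff₀ hpos] at h1
  exact h1

/-- The integrals of `|φ ∘ f|` over disjoint sets add up to at most its `L¹` norm. This is the `ℓ¹`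
bound behind the separable quotient. -/
theorem sum_norm_setIntegral_le {ι : Type*} {A : ι → Set Ω} (hA : ∀ n, MeasurableSet (A n))
    (hd : Pairwise (Function.onFun Disjoint A)) (φ : StrongDual 𝕜 X) (s : Finset ι)
    (f : PettisSpace 𝕜 μ X) :
    ∑ n ∈ s, ‖∫ ω in A n, φ ((f.1 : Ω → X) ω) ∂μ‖ ≤ ‖φ‖ * ‖f‖ := by
  have hint := (integrable_dual φ f).norm
  calc ∑ n ∈ s, ‖∫ ω in A n, φ ((f.1 : Ω → X) ω) ∂μ‖
      ≤ ∑ n ∈ s, ∫ ω in A n, ‖φ ((f.1 : Ω → X) ω)‖ ∂μ :=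
        Finset.sum_le_sum fun n _ => norm_integral_le_integral_norm _
    _ = ∫ ω in ⋃ n ∈ s, A n, ‖φ ((f.1 : Ω → X) ω)‖ ∂μ :=
        (integral_biUnion_finset s (fun n _ => hA n) (fun m _ n _ hmn => hd hmn)
          fun n _ => hint.integrableOn).symm
    _ ≤ ∫ ω, ‖φ ((f.1 : Ω → X) ω)‖ ∂μ :=
        setIntegral_le_integral hint (ae_of_all _ fun _ => norm_nonneg _)
    _ ≤ ‖φ‖ * ‖f‖ := (norm_toL1 φ f).symm.trans_le (norm_toL1_le φ f)

theorem norm_setIntegral_le {A : Set Ω} (hA : MeasurableSet A) (φ : StrongDual 𝕜 X)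
    (f : PettisSpace 𝕜 μ X) : ‖∫ ω in A, φ ((f.1 : Ω → X) ω) ∂μ‖ ≤ ‖φ‖ * ‖f‖ := by
  simpa using sum_norm_setIntegral_le (A := fun _ : Unit => A) (fun _ => hA)
    (fun m n hmn => (hmn rfl).elim) φ {()} f

/-- The functional `f ↦ ∫_A φ ∘ f dμ`. -/
noncomputable def setIntegralDual (φ : StrongDual 𝕜 X) {A : Set Ω} (hA : MeasurableSet A) :
    StrongDual 𝕜 (PettisSpace 𝕜 μ X) :=
  LinearMap.mkContinuous
    { toFun := fun f => ∫ ω in A, φ ((f.1 : Ω → X) ω) ∂μ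
      map_add' := fun f g => by
        rw [← integral_add (integrable_dual φ f).integrableOn (integrable_dual φ g).integrableOn]
        refine integral_congr_ae (ae_restrict_of_ae ?_)
        filter_upwards [coeFn_add f g] with ω hω
        simp [hω]
      map_smul' := fun c f => by
        rw [RingHom.id_apply, ← integral_smul]
        refine integral_congr_ae (ae_restrict_of_ae ?_)
        filter_upwards [coeFn_smul c f] with ω hω
        simp [hω] } ‖φ‖ (norm_setIntegral_le hA φ)

theorem setIntegralDual_apply (φ : StrongDual 𝕜 X) {A : Set Ω} (hA : MeasurableSet A)
    (f : PettisSpace 𝕜 μ X) :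
    setIntegralDual φ hA f = ∫ ω in A, φ ((f.1 : Ω → X) ω) ∂μ := rfl

/-- The Pettis integrals of a function over disjoint sets tend to zero in norm, hence uniformly on
bounded sets of functionals. -/
theorem tendsto_setIntegralDual {A : ℕ → Set Ω} (hA : ∀ n, MeasurableSet (A n))
    (hd : Pairwise (Function.onFun Disjoint A)) {φ : ℕ → StrongDual 𝕜 X} {D : ℝ}
    (hφ : ∀ n, ‖φ n‖ ≤ D) (f : PettisSpace 𝕜 μ X) :
    Tendsto (fun n => setIntegralDual (φ n) (hA n) f) atTop (𝓝 0) := by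
  choose x hx using fun n => f.2.2 (A n) (hA n)
  have hlim : Tendsto x atTop (𝓝 0) := by
    refine tendsto_zero_of_hasSum_indicator (𝕜 := 𝕜) fun S => ?_
    -- The Pettis integral over the union of the `A n`, `n ∈ S`, is the weak sum of the subseries
    -- over `S`.
    obtain ⟨y, hy⟩ := f.2.2 (⋃ n : S, A n) (MeasurableSet.iUnion fun n => hA n)
    refine ⟨y, fun θ => ?_⟩
    rw [← hasSum_subtype_iff_indicator, hy]
    simp only [Function.comp_def, hx]
    exact hasSum_integral_iUnion (fun n : S => hA n)
      (fun m n hmn => hd fun h => hmn (Subtype.ext h)) (integrable_dual θ f).integrableOn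
  refine squeeze_zero_norm (a := fun n => D * ‖x n‖) (fun n => ?_) ?_
  · rw [setIntegralDual_apply, ← hx]
    exact (φ n).le_of_opNorm_le (hφ n) _
  · simpa using hlim.norm.const_mul D

section Indicator

variable [IsFiniteMeasure μ]

theorem isPettisIntegrable_indicator {A : Set Ω} (hA : MeasurableSet A) (x : X) :
    IsPettisIntegrable 𝕜 μ (A.indicator fun _ => x) := by
  have h : ∀ φ : StrongDual 𝕜 X,
      (fun ω => φ (A.indicator (fun _ => x) ω)) = A.indicator fun _ => φ x := fun φ => by
    ext ω
    by_cases hω : ω ∈ A <;> simp [hω]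
  refine ⟨fun φ => ?_, fun B hB => ⟨(μ.real (B ∩ A) : 𝕜) • x, fun φ => ?_⟩⟩
  · rw [h]
    exact (integrable_const _).indicator hA
  · rw [h, setIntegral_indicator hA, setIntegral_const, map_smul, RCLike.real_smul_eq_coe_mul,
      smul_eq_mul]

variable (𝕜 μ) in
/-- The class of `μ(A)⁻¹ χ_A x`. -/
noncomputable def averagedIndicator {A : Set Ω} (hA : MeasurableSet A) (x : X) :
    PettisSpace 𝕜 μ X :=
  ⟨AEEqFun.mk (A.indicator fun _ => ((μ.real A)⁻¹ : 𝕜) • x)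
      (stronglyMeasurable_const.indicator hA).aestronglyMeasurable,
    (isPettisIntegrable_indicator hA _).congr (AEEqFun.coeFn_mk _ _).symm⟩

theorem coeFn_averagedIndicator {A : Set Ω} (hA : MeasurableSet A) (x : X) :
    ((averagedIndicator 𝕜 μ hA x).1 : Ω → X) =ᵐ[μ]
      A.indicator fun _ => ((μ.real A)⁻¹ : 𝕜) • x :=
  AEEqFun.coeFn_mk _ _

theorem setIntegralDual_averagedIndicator {A B : Set Ω} (hA : MeasurableSet A)
    (hB : MeasurableSet B) (φ : StrongDual 𝕜 X) (x : X) :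
    setIntegralDual φ hB (averagedIndicator 𝕜 μ hA x) =
      (μ.real (B ∩ A) : 𝕜) * ((μ.real A)⁻¹ : 𝕜) * φ x := by
  have h : (fun ω => φ (((averagedIndicator 𝕜 μ hA x).1 : Ω → X) ω)) =ᵐ[μ]
      A.indicator fun _ => ((μ.real A)⁻¹ : 𝕜) * φ x := by
    filter_upwards [coeFn_averagedIndicator (𝕜 := 𝕜) hA x] with ω hω
    rw [hω]
    by_cases hω : ω ∈ A <;> simp [hω]
  rw [setIntegralDual_apply, integral_congr_ae (ae_restrict_of_ae h), setIntegral_indicator hA,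
    setIntegral_const, RCLike.real_smul_eq_coe_mul, mul_assoc]

/-- The factor `μ(A)⁻¹` cancels the measure of `A`, so small sets do no harm. -/
theorem norm_toL1_averagedIndicator {A : Set Ω} (hA : MeasurableSet A) (h0 : μ A ≠ 0)
    (φ : StrongDual 𝕜 X) (x : X) : ‖toL1 φ (averagedIndicator 𝕜 μ hA x)‖ = ‖φ x‖ := by
  have hpos : 0 < μ.real A := ENNReal.toReal_pos h0 (measure_ne_top _ _)
  have h : (fun ω => ‖φ (((averagedIndicator 𝕜 μ hA x).1 : Ω → X) ω)‖) =ᵐ[μ]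
      A.indicator fun _ => (μ.real A)⁻¹ * ‖φ x‖ := by
    filter_upwards [coeFn_averagedIndicator (𝕜 := 𝕜) hA x] with ω hω
    rw [hω]
    by_cases hω : ω ∈ A <;> simp [hω]
  rw [norm_toL1, integral_congr_ae h, integral_indicator hA, setIntegral_const, smul_eq_mul,
    mul_inv_cancel_left₀ hpos.ne']

theorem setIntegralDual_averagedIndicator_eq_ite {A : ℕ → Set Ω} (hA : ∀ n, MeasurableSet (A n))
    (hd : Pairwise (Function.onFun Disjoint A)) (h0 : ∀ n, μ (A n) ≠ 0)
    {φ : ℕ → StrongDual 𝕜 X} {x : ℕ → X} (hφ : ∀ n, φ n (x n) = 1) (m n : ℕ) :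
    setIntegralDual (φ m) (hA m) (averagedIndicator 𝕜 μ (hA n) (x n)) =
      if m = n then 1 else 0 := by
  rw [setIntegralDual_averagedIndicator]
  split_ifs with hmn
  · subst hmn
    have hne : (μ.real (A m) : 𝕜) ≠ 0 := by
      exact_mod_cast (ENNReal.toReal_pos (h0 m) (measure_ne_top _ _)).ne'
    rw [Set.inter_self, mul_inv_cancel₀ hne, hφ, one_mul]
  · rw [(hd hmn).inter_eq]
    simp

theorem norm_sum_smul_averagedIndicator_le {A : ℕ → Set Ω} (hA : ∀ n, MeasurableSet (A n))
    (h0 : ∀ n, μ (A n) ≠ 0) {x : ℕ → X} {C : ℝ} {s : Finset ℕ}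
    (hx : ∀ φ : StrongDual 𝕜 X, ‖φ‖ ≤ 1 → ∑ n ∈ s, ‖φ (x n)‖ ≤ C) {a : ℕ → 𝕜} {r : ℝ}
    (hr : 0 ≤ r) (ha : ∀ n ∈ s, ‖a n‖ ≤ r) :
    ‖∑ n ∈ s, a n • averagedIndicator 𝕜 μ (hA n) (x n)‖ ≤ C * r := by
  refine norm_le_of_forall_toL1 fun φ hφ => ?_
  rw [map_sum]
  calc ‖∑ n ∈ s, toL1 φ (a n • averagedIndicator 𝕜 μ (hA n) (x n))‖
      ≤ ∑ n ∈ s, r * ‖φ (x n)‖ := by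
        refine norm_sum_le_of_le _ fun n hn => ?_
        rw [map_smul, norm_smul, norm_toL1_averagedIndicator _ (h0 n)]
        exact mul_le_mul_of_nonneg_right (ha n hn) (norm_nonneg _)
    _ ≤ C * r := by
        rw [← Finset.mul_sum, mul_comm C]
        exact mul_le_mul_of_nonneg_left (hx φ hφ) hr

end Indicator

end PettisSpace

/-! ### The unit vectors of a copy of `c₀` -/

section UnitVectors

variable {𝕜 : Type*} [RCLike 𝕜] {X : Type*} [NormedAddCommGroup X] [NormedSpace 𝕜 X]

/-- The vectors are images of the unit vectors of `c₀`, and Hahn–Banach extends the transported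
coordinate functionals to `X`. `C` and `D` are the norms of the embedding and of its inverse. -/
theorem ContainsCopy.exists_biorthogonal (h : ContainsCopy 𝕜 C₀(ℕ, 𝕜) X) :
    ∃ (x : ℕ → X) (φ : ℕ → StrongDual 𝕜 X) (C D : ℝ), (∀ n, φ n (x n) = 1) ∧
      (∀ n, ‖φ n‖ ≤ D) ∧
      ∀ (θ : StrongDual 𝕜 X) (s : Finset ℕ), ‖θ‖ ≤ 1 → ∑ n ∈ s, ‖θ (x n)‖ ≤ C := by
  obtain ⟨M, -, ⟨i⟩⟩ := h
  have hcoc : cocompact ℕ = atTop := by rw [cocompact_eq_cofinite, Nat.cofinite_eq_atTop]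
  let e : ℕ → C₀(ℕ, 𝕜) := fun n => ⟨⟨Pi.single n 1, continuous_of_discreteTopology⟩, by
    rw [hcoc]
    refine tendsto_const_nhds.congr' ((eventually_gt_atTop n).mono fun m hm => ?_)
    exact (Pi.single_eq_of_ne (M := fun _ => 𝕜) hm.ne' 1).symm⟩
  have he : ∀ n m, e n m = (Pi.single n 1 : ℕ → 𝕜) m := fun _ _ => rfl
  let δ : ℕ → StrongDual 𝕜 C₀(ℕ, 𝕜) := fun n => LinearMap.mkContinuous
    { toFun := fun a => a n
      map_add' := fun _ _ => rfl
      map_smul' := fun _ _ => rfl } 1 fun a => by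
        rw [one_mul]
        exact a.toBCF.norm_coe_le_norm n
  have hδ : ∀ n, ‖δ n‖ ≤ 1 := fun n => LinearMap.mkContinuous_norm_le _ zero_le_one _
  have hδapply : ∀ n a, δ n a = a n := fun _ _ => rfl
  let I : C₀(ℕ, 𝕜) →L[𝕜] X := M.subtypeL.comp (i : C₀(ℕ, 𝕜) →L[𝕜] M)
  choose φ hφ hφn using fun n =>
    exists_extension_norm_eq M ((δ n).comp (i.symm : M →L[𝕜] C₀(ℕ, 𝕜)))
  refine ⟨fun n => I (e n), φ, ‖I‖, ‖(i.symm : M →L[𝕜] C₀(ℕ, 𝕜))‖, fun n => ?_, fun n => ?_,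
    fun θ s hθ => ?_⟩
  · refine (hφ n (i (e n))).trans ?_
    simp [hδapply, he]
  · rw [hφn]
    refine (ContinuousLinearMap.opNorm_comp_le _ _).trans ?_
    exact mul_le_of_le_one_left (norm_nonneg _) (hδ n)
  -- Unimodular `c n` rotate each `θ (I (e n))` to its modulus, and `∑ c n • e n` stays in the unit
  -- ball of `c₀`.
  · choose c hc hcθ using fun n => RCLike.exists_norm_eq_mul_self (θ (I (e n)))
    have h1 : ‖∑ n ∈ s, c n • e n‖ ≤ 1 := by
      refine (BoundedContinuousFunction.norm_le zero_le_one).2 fun m => ?_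
      have h2 : (∑ n ∈ s, c n • e n) m = if m ∈ s then c m else 0 := by
        rw [← hδapply, map_sum]
        simp [hδapply, he, Pi.single_apply]
      change ‖(∑ n ∈ s, c n • e n) m‖ ≤ 1
      rw [h2]
      split_ifs <;> simp [hc]
    have h3 : ((∑ n ∈ s, ‖θ (I (e n))‖ : ℝ) : 𝕜) = θ (I (∑ n ∈ s, c n • e n)) := by
      simp [hcθ]
    calc ∑ n ∈ s, ‖θ (I (e n))‖ = ‖((∑ n ∈ s, ‖θ (I (e n))‖ : ℝ) : 𝕜)‖ := by
          rw [RCLike.norm_ofReal, abs_of_nonneg (Finset.sum_nonneg fun _ _ => norm_nonneg _)]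
      _ = ‖θ (I (∑ n ∈ s, c n • e n))‖ := by rw [h3]
      _ ≤ 1 * (‖I‖ * 1) := θ.le_of_opNorm_le_of_le hθ (I.le_of_opNorm_le_of_le le_rfl h1)
      _ = ‖I‖ := by ring

end UnitVectors

/-! ### The completion of the Pettis space -/

section Completion

variable {𝕜 : Type*} [RCLike 𝕜]

/-- For a bounded sequence of functionals, the points of pointwise convergence to zero form a closed
set. -/
theorem isClosed_setOf_tendsto_zero {E : Type*} [NormedAddCommGroup E] [NormedSpace 𝕜 E]
    {F : ℕ → StrongDual 𝕜 E} {D : ℝ} (hF : ∀ n f, ‖F n f‖ ≤ D * ‖f‖) :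
    IsClosed {f | Tendsto (fun n => F n f) atTop (𝓝 0)} := by
  refine isClosed_of_closure_subset fun f hf => Metric.tendsto_atTop.2 fun ε hε => ?_
  obtain ⟨g, hg, hfg⟩ := Metric.mem_closure_iff.1 hf (ε / 2 / (|D| + 1)) (by positivity)
  obtain ⟨N, hN⟩ := Metric.tendsto_atTop.1 hg (ε / 2) (by positivity)
  refine ⟨N, fun n hn => ?_⟩
  have h1 : ‖F n (f - g)‖ ≤ ε / 2 := by
    rw [dist_eq_norm] at hfg
    calc ‖F n (f - g)‖ ≤ D * ‖f - g‖ := hF _ _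
      _ ≤ (|D| + 1) * (ε / 2 / (|D| + 1)) := by
        refine mul_le_mul ?_ hfg.le (norm_nonneg _) (by positivity)
        linarith [le_abs_self D]
      _ = ε / 2 := mul_div_cancel₀ _ (by positivity)
  have h2 : ‖F n g‖ < ε / 2 := by simpa using hN n hn
  have h3 : F n f = F n (f - g) + F n g := by simp
  rw [dist_zero_right, h3]
  linarith [norm_add_le (F n (f - g)) (F n g)]

variable {Ω : Type*} [MeasurableSpace Ω] {μ : Measure Ω} [IsFiniteMeasure μ]
  {X : Type*} [NormedAddCommGroup X] [NormedSpace 𝕜 X]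

namespace PettisSpace

open UniformSpace

theorem hasSeparableQuotient_completion [Nontrivial X] {A : ℕ → Set Ω}
    (hA : ∀ n, MeasurableSet (A n)) (hd : Pairwise (Function.onFun Disjoint A))
    (h0 : ∀ n, μ (A n) ≠ 0) : HasSeparableQuotient 𝕜 (Completion (PettisSpace 𝕜 μ X)) := by
  obtain ⟨z, hz⟩ := exists_ne (0 : X)
  obtain ⟨φ, hφ, hφz⟩ := exists_dual_vector 𝕜 z (norm_ne_zero_iff.2 hz)
  let x : X := ((‖z‖ : 𝕜)⁻¹) • z
  have hx : φ x = 1 := by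
    rw [map_smul, hφz, smul_eq_mul, inv_mul_cancel₀]
    exact_mod_cast norm_ne_zero_iff.2 hz
  -- For a fixed finite `s` both sides are continuous in `f`, so the bound extends by density;
  -- summability then follows from bounded partial sums.
  have hsum : ∀ (s : Finset ℕ) (f : Completion (PettisSpace 𝕜 μ X)),
      ∑ n ∈ s, ‖(setIntegralDual φ (hA n)).fromCompletion f‖ ≤ ‖φ‖ * ‖f‖ := fun s f => by
    induction f using Completion.induction_on with
    | hp => exact isClosed_le (by fun_prop) (by fun_prop)
    | ih f =>
      simp only [ContinuousLinearMap.fromCompletion_apply_coe, Completion.norm_coe]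
      exact sum_norm_setIntegral_le hA hd φ s f
  refine hasSeparableQuotient_of_summable
    (F := fun n => (setIntegralDual φ (hA n)).fromCompletion)
    (g := fun n => (averagedIndicator 𝕜 μ (hA n) x : Completion (PettisSpace 𝕜 μ X)))
    (C := ‖x‖) (fun n => ?_) (fun m n => ?_)
    fun f => summable_of_sum_le (fun _ => norm_nonneg _) fun s => hsum s f
  · rw [Completion.norm_coe]
    refine norm_le_of_forall_toL1 fun θ hθ => ?_
    rw [norm_toL1_averagedIndicator _ (h0 n)]
    simpa using θ.le_of_opNorm_le hθ x
  · rw [ContinuousLinearMap.fromCompletion_apply_coe]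
    exact setIntegralDual_averagedIndicator_eq_ite hA hd h0 (φ := fun _ => φ) (fun _ => hx) m n

theorem containsComplementedCopy_completion {A : ℕ → Set Ω}
    (hA : ∀ n, MeasurableSet (A n)) (hd : Pairwise (Function.onFun Disjoint A))
    (h0 : ∀ n, μ (A n) ≠ 0) (hX : ContainsCopy 𝕜 C₀(ℕ, 𝕜) X) :
    ContainsComplementedCopy 𝕜 C₀(ℕ, 𝕜) (Completion (PettisSpace 𝕜 μ X)) := by
  obtain ⟨x, φ, C, D, hφx, hφ, hx⟩ := hX.exists_biorthogonal
  have hD : ∀ n (f : Completion (PettisSpace 𝕜 μ X)),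
      ‖(setIntegralDual (φ n) (hA n)).fromCompletion f‖ ≤ D * ‖f‖ := fun n f => by
    induction f using Completion.induction_on with
    | hp => exact isClosed_le (by fun_prop) (by fun_prop)
    | ih f =>
      rw [ContinuousLinearMap.fromCompletion_apply_coe, Completion.norm_coe]
      exact (norm_setIntegral_le (hA n) (φ n) f).trans
        (mul_le_mul_of_nonneg_right (hφ n) (norm_nonneg _))
  refine containsComplementedCopy_of_tendsto
    (F := fun n => (setIntegralDual (φ n) (hA n)).fromCompletion)
    (g := fun n => (averagedIndicator 𝕜 μ (hA n) (x n) : Completion (PettisSpace 𝕜 μ X)))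
    (C := C) (fun s a r hr ha => ?_) (fun m n => ?_) hD fun f => ?_
  · have h1 : ∑ n ∈ s, a n • (averagedIndicator 𝕜 μ (hA n) (x n) : Completion (PettisSpace 𝕜 μ X))
        = (Completion.toComplL (𝕜 := 𝕜) (∑ n ∈ s, a n • averagedIndicator 𝕜 μ (hA n) (x n)) :
          Completion (PettisSpace 𝕜 μ X)) := by
      rw [map_sum]
      simp
    rw [h1, Completion.coe_toComplL, Completion.norm_coe]
    exact norm_sum_smul_averagedIndicator_le hA h0 (fun θ hθ => hx θ s hθ) hr ha
  · rw [ContinuousLinearMap.fromCompletion_apply_coe]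
    exact setIntegralDual_averagedIndicator_eq_ite hA hd h0 hφx m n
  -- Orlicz–Pettis applies only to genuine Pettis integrable functions; density and the uniform
  -- bound `hD` cover the rest.
  · induction f using Completion.induction_on with
    | hp => exact isClosed_setOf_tendsto_zero hD
    | ih f =>
      simp only [ContinuousLinearMap.fromCompletion_apply_coe]
      exact tendsto_setIntegralDual hA hd hφ f

end PettisSpace

end Completion

theorem mainTheorem3 {𝕜 : Type*} [RCLike 𝕜] {Ω : Type*} [MeasurableSpace Ω]
    (μ : Measure Ω) [IsFiniteMeasure μ]
    {X : Type*} [NormedAddCommGroup X] [NormedSpace 𝕜 X] [CompleteSpace X]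
    (hX : ¬ FiniteDimensional 𝕜 X) :
    (¬ IsPurelyAtomic μ →
      HasSeparableQuotient 𝕜 (UniformSpace.Completion (PettisSpace 𝕜 μ X))) ∧
    (Set.Infinite {r : ENNReal | ∃ A : Set Ω, MeasurableSet A ∧ μ A = r} →
      ContainsCopy 𝕜 C₀(ℕ, 𝕜) X →
      ContainsComplementedCopy 𝕜 C₀(ℕ, 𝕜)
        (UniformSpace.Completion (PettisSpace 𝕜 μ X))) := by
  refine ⟨fun h => ?_, fun h hc => ?_⟩
  · have : Nontrivial X := not_subsingleton_iff_nontrivial.1 fun _ => hX inferInstance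
    obtain ⟨A, hA, hd, h0⟩ := exists_pairwise_disjoint_of_not_isPurelyAtomic h
    exact PettisSpace.hasSeparableQuotient_completion hA hd h0
  · obtain ⟨A, hA, hd, h0⟩ := exists_pairwise_disjoint_of_infinite_range h
    exact PettisSpace.containsComplementedCopy_completion hA hd h0 hc
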